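/- Let $n\ge 3$ and let $W_n$ be the wheel graph: a cycle on the vertices $v_0,\dots,v_{n-1}$ (indices modulo $n$) together with one further vertex $s$ adjacent to every $v_i$. Take $s$ as the sink. A sandpile on $W_n$ is a function $c:\{v_0,\dots,v_{n-1}\}\to\mathbb{Z}_{\ge 0}$. A vertex $v_i$ is unstable if $c(v_i)\ge \deg(v_i)$, and an unstable vertex topples by sending one grain along each of its edges (grains sent to $s$ are lost). A sandpile is stable if it has no unstable vertex; the stabilization of a sandpile is the stable sandpile reached by toppling unstable vertices, and its toppling vector $(t_0,\dots,t_{n-1})$ records how many times each $v_i$ topples (neither depends on the order of topplings). A stable sandpile $c$ is recurrent if for every sandpile $a$ there is a sandpile $b$ such that $c$ is the stabilization of $a+b$. The multivariate avalanche polynomial of $W_n$ is $$\mathscr{A}_{W_n}(x_0,\dots,x_{n-1})=\sum_{c\ \text{recurrent}}\ \sum_{k=0}^{n-1}\ \prod_{i=0}^{n-1}x_i^{t_i(c,k)},$$ where $(t_0(c,k),\dots,t_{n-1}(c,k))$ is the toppling vector of the stabilization of $c+1_{v_k}$, the sandpile obtained from $c$ by adding one grain at $v_k$. For $1\le m\le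 n-1$ let $$w_m=\sum_{i=0}^{n-1}x_i x_{i+1}\cdots x_{i+m-1}\qquad(\text{indices modulo } n),$$ and let $(f_k)$ be the Fibonacci numbers with $f_0=0$, $f_1=f_2=1$, $f_{k}=f_{k-1}+f_{k-2}$. Then $$\mathscr{A}_{W_n}=n^2\,x_0x_1\cdots x_{n-1}+\sum_{m=1}^{n-1} m\,f_{2(n-m)}\,w_m+2n\,(f_{2n-1}-1).$$ -/

import Mathlib

namespace AvalancheGraph

/-- A sandpile on a graph with vertex set `V` and sink `s`: a number of grains on each
non-sink vertex. -/
abbrev Sandpile {V : Type*} (s : V) : Type _ := {v : V // v ≠ s} → ℕ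

section Sandpiles

variable {V : Type*} [Fintype V] [DecidableEq V] (G : SimpleGraph V) [DecidableRel G.Adj] {s : V}

/-- The non-sink vertex `v` is unstable: it has at least as many grains as its degree in `G`
(edges to the sink are counted). -/
def IsUnstableAt (c : Sandpile s) (v : {v : V // v ≠ s}) : Prop :=
  G.degree v.1 ≤ c v

/-- A sandpile is stable if no non-sink vertex is unstable. -/
def IsStable (c : Sandpile s) : Prop :=
  ∀ v, c v < G.degree v.1

/-- The sandpile obtained by toppling `v`: one grain is sent along every edge at `v`.
Only used when `v` is unstable, so that the subtraction is exact. -/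
def topple (c : Sandpile s) (v : {v : V // v ≠ s}) : Sandpile s := fun w =>
  if w = v then c v - G.degree v.1 else c w + (if G.Adj v.1 w.1 then 1 else 0)

/-- `TopplesTo G c l c'`: toppling the vertices of the list `l` in order, each of them being
unstable at the moment when it topples, sends `c` to `c'`. -/
inductive TopplesTo : Sandpile s → List {v : V // v ≠ s} → Sandpile s → Prop
  | nil (c : Sandpile s) : TopplesTo c [] c
  | cons {c c' : Sandpile s} {v : {v : V // v ≠ s}} {l : List {v : V // v ≠ s}}
      (hv : IsUnstableAt G c v) (h : TopplesTo (topple G c v) l c') : TopplesTo c (v :: l) c'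

/-- `c'` is the stabilization of `c`: it is stable and is reached from `c` by a sequence of
topplings of unstable vertices. -/
def IsStabilization (c c' : Sandpile s) : Prop :=
  IsStable G c' ∧ ∃ l, TopplesTo G c l c'

/-- A sandpile `c` is recurrent if it is stable and for every sandpile `a` there is a sandpile
`b` such that `c` is the stabilization of `a + b`. -/
def IsRecurrent (c : Sandpile s) : Prop :=
  IsStable G c ∧ ∀ a : Sandpile s, ∃ b : Sandpile s, IsStabilization G (a + b) c

/-- `f` is the toppling vector of a stabilization of `c`: `f v` is the number of times that `v`
topples. -/
def IsTopplingVector (c : Sandpile s) (f : {v : V // v ≠ s} → ℕ) : Prop :=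
  ∃ (l : List {v : V // v ≠ s}) (c' : Sandpile s),
    TopplesTo G c l c' ∧ IsStable G c' ∧ ∀ v, f v = l.count v

open Classical in
/-- The toppling vector of the stabilization of `c`. On a connected graph it exists and does
not depend on the order of the topplings. -/
noncomputable def topplingVector (c : Sandpile s) : {v : V // v ≠ s} → ℕ :=
  if h : ∃ f, IsTopplingVector G c f then h.choose else 0

/-- The avalanche monomial of `c` at `v`: the monomial whose exponents are the entries of the
toppling vector of the stabilization of `c + 1_v`. -/
noncomputable def avalancheMonomial (c : Sandpile s) (v : {v : V // v ≠ s}) :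
    MvPolynomial {v : V // v ≠ s} ℤ :=
  ∏ u, MvPolynomial.X u ^ topplingVector G (c + Pi.single v 1) u

open Classical in
/-- The finite set of recurrent sandpiles on `G` with sink `s`. -/
noncomputable def recurrents (s : V) : Finset (Sandpile s) :=
  (Fintype.piFinset fun v : {v : V // v ≠ s} => Finset.range (G.degree v.1)).filter
    fun c => IsRecurrent G c

theorem mem_recurrents (c : Sandpile s) : c ∈ recurrents G s ↔ IsRecurrent G c := by
  simp only [recurrents, Finset.mem_filter, Fintype.mem_piFinset, Finset.mem_range]
  exact ⟨fun h => h.2, fun h => ⟨h.1, h⟩⟩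

/-- The multivariate avalanche polynomial of `G` with sink `s`. -/
noncomputable def avalanchePolynomial (s : V) : MvPolynomial {v : V // v ≠ s} ℤ :=
  ∑ c ∈ recurrents G s, ∑ v, avalancheMonomial G c v

end Sandpiles

/-- Adjacency in the wheel: `some i` are the vertices of the cycle, `none` is the dominating
vertex. -/
def wheelAdj (n : ℕ) : Option (Fin n) → Option (Fin n) → Prop
  | none, none => False
  | none, some _ => True
  | some _, none => True
  | some i, some j => (SimpleGraph.cycleGraph n).Adj i j

/-- The wheel graph: a cycle on `n` vertices and a dominating vertex. -/
def wheelGraph (n : ℕ) : SimpleGraph (Option (Fin n)) where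
  Adj := wheelAdj n
  symm := ⟨by
    rintro (_ | i) (_ | j) h
    · exact h
    · trivial
    · trivial
    · exact SimpleGraph.Adj.symm (G := SimpleGraph.cycleGraph n) h⟩
  loopless := ⟨by
    rintro (_ | i) h
    · exact h
    · exact (SimpleGraph.cycleGraph n).irrefl h⟩

instance (n : ℕ) : DecidableRel (wheelGraph n).Adj
  | none, none => inferInstanceAs (Decidable False)
  | none, some _ => inferInstanceAs (Decidable True)
  | some _, none => inferInstanceAs (Decidable True)
  | some i, some j => inferInstanceAs (Decidable ((SimpleGraph.cycleGraph n).Adj i j))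

/-- The variable `x_i` attached to the cycle vertex `i` of the wheel. -/
noncomputable def wheelVar (n : ℕ) (i : Fin n) :
    MvPolynomial {v : Option (Fin n) // v ≠ none} ℤ :=
  MvPolynomial.X ⟨some i, Option.some_ne_none i⟩

/-- The cyclic polynomial `∑ i, x_i x_{i+1} ⋯ x_{i+m-1}`, indices modulo `n`. -/
def cyclicPolynomial {R : Type*} [CommSemiring R] {n : ℕ} (m : ℕ) (x : Fin n → R) : R :=
  ∑ i : Fin n, ∏ k ∈ Finset.range m, x ⟨(i.1 + k) % n, Nat.mod_lt _ i.pos⟩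

end AvalancheGraph

/-!
By the least action principle every legal stabilization of a sandpile has the same toppling vector.
For a sink adjacent to all other vertices, recurrence is Dhar's criterion: no nonempty set `S` of
vertices has at each of its vertices fewer grains than neighbours in `S`. Stable sandpiles on the
wheel are cyclic words on `0`, `1`, `2`, and such a word is recurrent exactly when it is not
constant equal to `1` and, going around the cycle, each letter `0` is followed by a letter `2`
before the next `0`. An automaton with two states recognises these words, so they are counted by
traces of products of `2 × 2` matrices, whence the Fibonacci numbers.

Adding a grain at a letter `0` or `1` of a recurrent word topples nothing. If at most one letter is
not `2`, and that letter is a `1`, then adding a grain at a letter `2` makes every vertex of the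
cycle topple once; there are `1 + n` such words, which contain `n + n (n - 1) = n ^ 2` letters `2`.
In every other word, a grain added at a letter `2` topples each vertex of the maximal block of
letters `2` around it once and no other vertex, so a block of length `m` yields `m` times the same
monomial. A given block of length `m` is maximal in `f_{2(n-m)}` of these words.
-/

namespace AvalancheGraph

section DegreeIn

variable {V : Type*} {G : SimpleGraph V} [DecidableRel G.Adj] {s : V}

variable (G) in
/-- The number of neighbours of `v` in a set `T` of non-sink vertices: the number of grains that
`v` receives when every vertex of `T` topples once. -/
def degreeIn (T : Finset {v : V // v ≠ s}) (v : V) : ℕ :=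
  (T.filter fun w => G.Adj w.1 v).card

variable [DecidableEq V]

theorem degreeIn_insert {T : Finset {v : V // v ≠ s}} {u : {v : V // v ≠ s}} (hu : u ∉ T) (v : V) :
    degreeIn G (insert u T) v = degreeIn G T v + if G.Adj u.1 v then 1 else 0 := by
  rw [degreeIn, Finset.filter_insert]
  split_ifs
  · exact Finset.card_insert_of_notMem fun h => hu (Finset.mem_filter.1 h).1
  · rfl

theorem degreeIn_sdiff_add {S T : Finset {v : V // v ≠ s}} (h : S ⊆ T) (v : V) :
    degreeIn G (T \ S) v + degreeIn G S v = degreeIn G T v := by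
  simp only [degreeIn, Finset.card_filter]
  exact Finset.sum_sdiff h

theorem countP_adj_eq_degreeIn {l : List {v : V // v ≠ s}} (hl : l.Nodup) (v : V) :
    l.countP (fun w => G.Adj w.1 v) = degreeIn G l.toFinset v := by
  rw [degreeIn, List.countP_eq_length_filter, ← List.toFinset_card_of_nodup (hl.filter _),
    List.toFinset_filter]
  simp only [decide_eq_true_eq]

end DegreeIn

section Sandpiles

open scoped List

variable {V : Type*} [Fintype V] [DecidableEq V] {G : SimpleGraph V} [DecidableRel G.Adj] {s : V}

theorem TopplesTo.apply_add_count_mul {c c' : Sandpile s} {l : List {v : V // v ≠ s}}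
    (h : TopplesTo G c l c') (v : {v : V // v ≠ s}) :
    c' v + l.count v * G.degree v.1 = c v + l.countP fun w => G.Adj w.1 v.1 := by
  induction h with
  | nil c => simp
  | @cons c c' u l hu _ ih =>
    rw [IsUnstableAt] at hu
    by_cases huv : v = u
    · subst huv
      simp only [topple, if_true] at ih
      simp only [List.count_cons_self, add_mul, one_mul, List.countP_cons, SimpleGraph.irrefl,
        decide_false, Bool.false_eq_true, if_false]
      omega
    · simp only [topple, if_neg huv] at ih
      simp only [List.count_cons_of_ne (Ne.symm huv), List.countP_cons, decide_eq_true_eq]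
      omega

theorem TopplesTo.add_right {c c' : Sandpile s} {l : List {v : V // v ≠ s}}
    (h : TopplesTo G c l c') (d : Sandpile s) : TopplesTo G (c + d) l (c' + d) := by
  induction h with
  | nil c => exact .nil _
  | @cons c c' u l hu _ ih =>
    have htopple : topple G (c + d) u = topple G c u + d := by
      rw [IsUnstableAt] at hu
      funext w
      simp only [topple, Pi.add_apply]
      split_ifs with hw
      · subst hw
        omega
      all_goals omega
    exact .cons (le_add_right hu) (htopple ▸ ih)

theorem TopplesTo.append {c c' c'' : Sandpile s} {l l' : List {v : V // v ≠ s}}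
    (h : TopplesTo G c l c') (h' : TopplesTo G c' l' c'') : TopplesTo G c (l ++ l') c'' := by
  induction h with
  | nil c => exact h'
  | cons hu _ ih => exact .cons hu (ih h')

theorem TopplesTo.exists_of_append {l l' : List {v : V // v ≠ s}} {c c'' : Sandpile s}
    (h : TopplesTo G c (l ++ l') c'') : ∃ c', TopplesTo G c l c' ∧ TopplesTo G c' l' c'' := by
  induction l generalizing c with
  | nil => exact ⟨c, .nil _, h⟩
  | cons u l ih =>
    obtain _ | ⟨hu, h⟩ := h
    obtain ⟨c', h₁, h₂⟩ := ih h
    exact ⟨c', .cons hu h₁, h₂⟩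

/-- The least action principle. -/
theorem TopplesTo.subperm_of_isStable {c c₁ c₂ : Sandpile s} {l₁ l₂ : List {v : V // v ≠ s}}
    (h₁ : TopplesTo G c l₁ c₁) (h₂ : TopplesTo G c l₂ c₂) (hc₂ : IsStable G c₂) : l₁ <+~ l₂ := by
  induction l₁ using List.reverseRecOn generalizing c₁ with
  | nil => exact List.nil_subperm
  | append_singleton l₁ u ih =>
    obtain ⟨c', h₁, h⟩ := h₁.exists_of_append
    obtain _ | ⟨hu, -⟩ := h
    have hsub : l₁ <+~ l₂ := ih h₁
    have hlt : l₁.count u < l₂.count u := by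
      refine (hsub.count_le u).lt_of_ne fun heq => ?_
      have hbal₁ := h₁.apply_add_count_mul u
      have hbal₂ := h₂.apply_add_count_mul u
      have hle := hsub.countP_le fun w => G.Adj w.1 u.1
      have := hc₂ u
      rw [IsUnstableAt] at hu
      rw [heq] at hbal₁
      omega
    refine List.subperm_ext_iff.2 fun v _ => ?_
    rw [List.count_append, List.count_singleton]
    split_ifs with huv
    · rw [← eq_of_beq huv]
      exact hlt
    · exact hsub.count_le v

theorem IsTopplingVector.topplingVector_eq {c : Sandpile s} {f : {v : V // v ≠ s} → ℕ}
    (hf : IsTopplingVector G c f) : topplingVector G c = f := by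
  have hex : ∃ f, IsTopplingVector G c f := ⟨f, hf⟩
  rw [topplingVector, dif_pos hex]
  obtain ⟨l, c', h, hc', hl⟩ := hf
  obtain ⟨l₂, c₂, h₂, hc₂, hl₂⟩ := hex.choose_spec
  funext v
  rw [hl₂, hl]
  exact ((h₂.subperm_of_isStable h hc').antisymm (h.subperm_of_isStable h₂ hc₂)).count_eq v

theorem degree_eq_degreeIn_univ_add (v : {v : V // v ≠ s}) :
    G.degree v.1 = degreeIn G (Finset.univ : Finset {v : V // v ≠ s}) v.1
      + if G.Adj v.1 s then 1 else 0 := by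
  rw [degreeIn, ← G.card_neighborFinset_eq_degree, SimpleGraph.neighborFinset_eq_filter,
    Finset.card_filter, Finset.card_filter, ← Finset.sum_erase_add _ _ (Finset.mem_univ s)]
  simp only [G.adj_comm v.1]
  rw [Finset.sum_subtype (p := (· ≠ s)) _ (by simp)]

/-- Since toppling a vertex outside `S` only adds grains to `S`, the order of the topplings can be
left open: it is enough that no nonempty `S ⊆ T` blocks once the rest of `T` has toppled. -/
theorem exists_topplesTo_of_forall_subset (c : Sandpile s) (T : Finset {v : V // v ≠ s})
    (hT : ∀ S ⊆ T, S.Nonempty → ∃ v ∈ S, G.degree v.1 ≤ c v + degreeIn G (T \ S) v) :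
    ∃ l : List {v : V // v ≠ s}, l.Nodup ∧ l.toFinset = T ∧ ∃ c', TopplesTo G c l c' := by
  induction T using Finset.strongInduction generalizing c with
  | H T ih =>
    obtain rfl | hne := T.eq_empty_or_nonempty
    · exact ⟨[], List.nodup_nil, rfl, c, .nil _⟩
    obtain ⟨v, hvT, hv⟩ := hT T subset_rfl hne
    have hunstable : IsUnstableAt G c v := by simpa [IsUnstableAt, degreeIn] using hv
    obtain ⟨l, hl, hlT, c', h⟩ := ih (T.erase v) (Finset.erase_ssubset hvT) (topple G c v) <| by
      intro S hS hSne
      obtain ⟨u, huS, hu⟩ := hT S (hS.trans (Finset.erase_subset v T)) hSne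
      have hvS : v ∉ S := fun h => Finset.notMem_erase v T (hS h)
      have huv : u ≠ v := ne_of_mem_of_not_mem huS hvS
      have hinsert : T \ S = insert v (T.erase v \ S) := by
        rw [← Finset.insert_sdiff_of_notMem _ hvS, Finset.insert_erase hvT]
      rw [hinsert, degreeIn_insert (by simp)] at hu
      refine ⟨u, huS, ?_⟩
      rw [topple, if_neg huv]
      omega
    refine ⟨v :: l, List.nodup_cons.2 ⟨?_, hl⟩, ?_, c', .cons hunstable h⟩
    · rw [← List.mem_toFinset, hlT]
      exact Finset.notMem_erase v T
    · rw [List.toFinset_cons, hlT, Finset.insert_erase hvT]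

theorem TopplesTo.apply_add_ite_of_nodup {c c' : Sandpile s} {l : List {v : V // v ≠ s}}
    (h : TopplesTo G c l c') (hl : l.Nodup) (v : {v : V // v ≠ s}) :
    c' v + (if v ∈ l.toFinset then G.degree v.1 else 0) = c v + degreeIn G l.toFinset v := by
  rw [← countP_adj_eq_degreeIn hl, ← h.apply_add_count_mul, hl.count]
  simp

theorem topplingVector_eq_indicator (c : Sandpile s) (T : Finset {v : V // v ≠ s})
    (hT : ∀ S ⊆ T, S.Nonempty → ∃ v ∈ S, G.degree v.1 ≤ c v + degreeIn G (T \ S) v)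
    (hstable : ∀ v, c v + degreeIn G T v < G.degree v.1 + if v ∈ T then G.degree v.1 else 0) :
    topplingVector G c = fun v => if v ∈ T then 1 else 0 := by
  obtain ⟨l, hl, rfl, c', h⟩ := exists_topplesTo_of_forall_subset c T hT
  refine IsTopplingVector.topplingVector_eq ⟨l, c', h, fun v => ?_, fun v => ?_⟩
  · have := h.apply_add_ite_of_nodup hl v
    have := hstable v
    omega
  · simp [hl.count]

/-- The vertex of `S` whose last toppling comes first receives a grain from every other one of its
neighbours in `S` afterwards. -/
theorem TopplesTo.exists_degreeIn_le {c c' : Sandpile s} {l : List {v : V // v ≠ s}}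
    (h : TopplesTo G c l c') {S : Finset {v : V // v ≠ s}} (hS : S.Nonempty)
    (hSl : S ⊆ l.toFinset) : ∃ v ∈ S, degreeIn G S v ≤ c' v := by
  induction h with
  | nil c => exact absurd (Finset.subset_empty.1 hSl) hS.ne_empty
  | @cons c c' u l _ h ih =>
    by_cases hS' : S ⊆ l.toFinset
    · exact ih hS'
    obtain ⟨v, hvS, hvl⟩ := Finset.not_subset.1 hS'
    rw [List.mem_toFinset] at hvl
    obtain rfl : v = u := by simpa [hvl] using hSl hvS
    refine ⟨v, hvS, ?_⟩
    have hle : degreeIn G S v ≤ l.countP fun w => G.Adj w.1 v.1 := by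
      rw [degreeIn, List.countP_eq_length_filter]
      refine le_trans (Finset.card_le_card fun w hw => ?_) (List.toFinset_card_le _)
      obtain ⟨hwS, hwv⟩ := Finset.mem_filter.1 hw
      have hne : w ≠ v := fun h => G.irrefl (h ▸ hwv)
      have hwl : w ∈ l := by simpa [hne] using hSl hwS
      simpa using ⟨hwl, hwv⟩
    have hbal := h.apply_add_count_mul v
    rw [List.count_eq_zero_of_not_mem hvl, topple, if_pos rfl] at hbal
    omega

theorem IsRecurrent.exists_degreeIn_le {c : Sandpile s} (hc : IsRecurrent G c)
    {S : Finset {v : V // v ≠ s}} (hS : S.Nonempty) : ∃ v ∈ S, degreeIn G S v ≤ c v := by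
  obtain ⟨hstable, h⟩ := hc
  obtain ⟨b, -, l, hl⟩ := h fun v => G.degree v.1
  refine hl.exists_degreeIn_le hS fun v _ => List.mem_toFinset.2 ?_
  by_contra hv
  have hbal := hl.apply_add_count_mul v
  rw [List.count_eq_zero_of_not_mem hv, Pi.add_apply] at hbal
  have := hstable v
  omega

theorem exists_topplesTo_add_one (hs : ∀ v : {v : V // v ≠ s}, G.Adj v.1 s) {c : Sandpile s}
    (hc : ∀ S : Finset {v : V // v ≠ s}, S.Nonempty → ∃ v ∈ S, degreeIn G S v ≤ c v) :
    ∃ l, TopplesTo G (c + 1) l c := by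
  have hdeg : ∀ v : {v : V // v ≠ s},
      G.degree v.1 = degreeIn G (Finset.univ : Finset {v : V // v ≠ s}) v.1 + 1 := fun v => by
    rw [degree_eq_degreeIn_univ_add v, if_pos (hs v)]
  obtain ⟨l, hl, hluniv, c', h⟩ :=
      exists_topplesTo_of_forall_subset (G := G) (c + 1) Finset.univ <| by
    intro S _ hS
    obtain ⟨v, hvS, hv⟩ := hc S hS
    refine ⟨v, hvS, ?_⟩
    rw [hdeg, ← degreeIn_sdiff_add (Finset.subset_univ S), Pi.add_apply, Pi.one_apply]
    omega
  have hc' : c' = c := by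
    funext v
    have hbal := h.apply_add_ite_of_nodup hl v
    rw [hluniv, if_pos (Finset.mem_univ v), hdeg, Pi.add_apply, Pi.one_apply] at hbal
    omega
  exact ⟨l, hc' ▸ h⟩

theorem exists_topplesTo_add_const {c : Sandpile s} (hc : ∃ l, TopplesTo G (c + 1) l c) (k : ℕ) :
    ∃ l, TopplesTo G (c + fun _ => k) l c := by
  induction k with
  | zero => exact ⟨[], .nil c⟩
  | succ k ih =>
    obtain ⟨l, hl⟩ := ih
    obtain ⟨l', hl'⟩ := hc
    have hadd : c + (fun _ => k + 1) = c + 1 + fun _ => k := by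
      funext v
      simp only [Pi.add_apply, Pi.one_apply]
      omega
    exact ⟨l' ++ l, hadd ▸ (hl'.add_right _).append hl⟩

/-- Dhar's burning criterion, for a sink adjacent to every other vertex. -/
theorem isRecurrent_iff_of_forall_adj (hs : ∀ v : {v : V // v ≠ s}, G.Adj v.1 s) (c : Sandpile s) :
    IsRecurrent G c ↔ IsStable G c ∧
      ∀ S : Finset {v : V // v ≠ s}, S.Nonempty → ∃ v ∈ S, degreeIn G S v ≤ c v := by
  refine ⟨fun h => ⟨h.1, fun S hS => h.exists_degreeIn_le hS⟩, fun ⟨hstable, h⟩ => ⟨hstable, ?_⟩⟩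
  intro a
  have hadd : a + (fun v => c v + (∑ u, a u - a v)) = c + fun _ => ∑ u, a u := by
    funext v
    have := Finset.single_le_sum (f := a) (fun _ _ => Nat.zero_le _) (Finset.mem_univ v)
    simp only [Pi.add_apply]
    omega
  exact ⟨_, hstable, hadd ▸ exists_topplesTo_add_const (exists_topplesTo_add_one hs h) (∑ v, a v)⟩

end Sandpiles

section Words

variable {n : ℕ} {c : ZMod n → Fin 3}

theorem forall_of_forall_add_one [NeZero n] {P : ZMod n → Prop} (hP : ∀ i, P i → P (i + 1))
    {i : ZMod n} (hi : P i) (j : ZMod n) : P j := by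
  have hadd : ∀ k : ℕ, P (i + k) := fun k => by
    induction k with
    | zero => simpa using hi
    | succ k ih => simpa only [Nat.cast_succ, add_assoc] using hP _ ih
  simpa using hadd (j - i).val

theorem forall_of_forall_sub_one [NeZero n] {P : ZMod n → Prop} (hP : ∀ i, P i → P (i - 1))
    {i : ZMod n} (hi : P i) (j : ZMod n) : P j := by
  by_contra hj
  refine forall_of_forall_add_one (P := fun k => ¬P k) (fun k hk h => hk ?_) hj i hi
  simpa using hP _ h

/-- The number of neighbours of `i` on the cycle `ZMod n` that lie in `S`, a neighbour being counted
twice if `i + 1 = i - 1`. -/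
def cyclicDegree (S : Finset (ZMod n)) (i : ZMod n) : ℕ :=
  (if i + 1 ∈ S then 1 else 0) + if i - 1 ∈ S then 1 else 0

theorem cyclicDegree_mono {S T : Finset (ZMod n)} (h : S ⊆ T) (i : ZMod n) :
    cyclicDegree S i ≤ cyclicDegree T i := by
  have hadd := @h (i + 1)
  have hsub := @h (i - 1)
  grind [cyclicDegree]

/-- A stable sandpile on the wheel, read as a cyclic word on `0`, `1`, `2`, meets Dhar's criterion
for recurrence. -/
def IsRecurrentWord (c : ZMod n → Fin 3) : Prop :=
  ∀ S : Finset (ZMod n), S.Nonempty → ∃ i ∈ S, cyclicDegree S i ≤ (c i : ℕ)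

theorem IsRecurrentWord.comp_add_right (hc : IsRecurrentWord c) (a : ZMod n) :
    IsRecurrentWord fun i => c (i + a) := by
  intro S hS
  obtain ⟨_, hi, hle⟩ := hc (S.map (addRightEmbedding a)) hS.map
  obtain ⟨i, hiS, rfl⟩ := Finset.mem_map.1 hi
  refine ⟨i, hiS, le_trans (le_of_eq ?_) hle⟩
  have hadd : i + a + 1 = i + 1 + a := by ring
  have hsub : i + a - 1 = i - 1 + a := by ring
  simp [cyclicDegree, hadd, hsub]

theorem isRecurrentWord_comp_add_right_iff (a : ZMod n) :
    (IsRecurrentWord fun i => c (i + a)) ↔ IsRecurrentWord c :=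
  ⟨fun h => by simpa using h.comp_add_right (-a), fun h => h.comp_add_right a⟩

theorem isRecurrentWord_of_forall_ne [Fact (1 < n)] {j : ZMod n} (hc : ∀ i ≠ j, c i = 2) :
    IsRecurrentWord c := by
  intro S hS
  by_cases h : ∃ i ∈ S, i ≠ j
  · obtain ⟨i, hi, hij⟩ := h
    refine ⟨i, hi, ?_⟩
    rw [hc i hij, cyclicDegree]
    split_ifs <;> decide
  · push Not at h
    obtain ⟨i, hi⟩ := hS
    obtain rfl := h i hi
    have hadd : i + 1 ∉ S := fun h' => one_ne_zero (add_eq_left.1 (h _ h'))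
    have hsub : i - 1 ∉ S := fun h' => one_ne_zero (sub_eq_self.1 (h _ h'))
    exact ⟨i, hi, by simp [cyclicDegree, hadd, hsub]⟩

/-- The transitions of the automaton recognising recurrent words: the state `0` says that the last
letter other than `1` was a `0`, and a second `0` cannot be read from it; the state `1` says that it
was a `2`. -/
def Step (a : Fin 3) (s u : Fin 2) : Prop :=
  (a = 0 ∧ s = 1 ∧ u = 0) ∨ (a = 1 ∧ u = s) ∨ (a = 2 ∧ u = 1)

instance (a : Fin 3) (s u : Fin 2) : Decidable (Step a s u) :=
  inferInstanceAs (Decidable (_ ∨ _))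

/-- `σ` is a closed run of the automaton along the cyclic word `c`. -/
def IsTrack (c : ZMod n → Fin 3) (σ : ZMod n → Fin 2) : Prop :=
  ∀ i, Step (c i) (σ i) (σ (i + 1))

instance [NeZero n] (c : ZMod n → Fin 3) : DecidablePred (IsTrack c) :=
  fun σ => inferInstanceAs (Decidable (∀ i, Step (c i) (σ i) (σ (i + 1))))

theorem IsTrack.eq_one_of_ne [NeZero n] {σ τ : ZMod n → Fin 2} (hσ : IsTrack c σ)
    (hτ : IsTrack c τ) {i : ZMod n} (hi : σ i ≠ τ i) : c = 1 := by
  have hstep : ∀ a s u s' u', Step a s u → Step a s' u' → u ≠ u' → a = 1 ∧ s ≠ s' := by decide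
  have hne : ∀ j, σ j ≠ τ j := forall_of_forall_sub_one (fun j hj => by
    rw [← sub_add_cancel j 1] at hj
    exact (hstep _ _ _ _ _ (hσ _) (hτ _) hj).2) hi
  exact funext fun j => (hstep _ _ _ _ _ (hσ j) (hτ j) (hne (j + 1))).1

theorem IsTrack.isRecurrentWord [NeZero n] {σ : ZMod n → Fin 2} (hσ : IsTrack c σ) (hc : c ≠ 1) :
    IsRecurrentWord c := by
  intro S ⟨i₀, hi₀⟩
  by_contra! hS
  have hzero : ∀ i, c i = 0 → σ i = 1 ∧ σ (i + 1) = 0 := fun i hi => by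
    simpa [Step, hi] using hσ i
  have hone : ∀ i, c i = 1 → σ (i + 1) = σ i := fun i hi => by simpa [Step, hi] using hσ i
  have hletter : ∀ i ∈ S, (c i = 0 ∧ (i + 1 ∈ S ∨ i - 1 ∈ S)) ∨
      (c i = 1 ∧ i + 1 ∈ S ∧ i - 1 ∈ S) := fun i hi => by
    have h := hS i hi
    revert h
    generalize c i = a
    rw [cyclicDegree]
    split_ifs <;> fin_cases a <;> simp [*]
  have hok : ∀ i ∈ S, σ i = 1 := by
    by_contra! h
    obtain ⟨i, hi, hσi⟩ := h
    have hall : ∀ j, j ∈ S ∧ σ j ≠ 1 := forall_of_forall_add_one (fun j ⟨hj, hσj⟩ => by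
      obtain ⟨h0, -⟩ | ⟨h1, hadd, -⟩ := hletter j hj
      · exact absurd (hzero j h0).1 hσj
      · exact ⟨hadd, hone j h1 ▸ hσj⟩) ⟨hi, hσi⟩
    refine hc (funext fun j => ?_)
    obtain ⟨h0, -⟩ | ⟨h1, -⟩ := hletter j (hall j).1
    · exact absurd (hzero j h0).1 (hall j).2
    · exact h1
  have hne : ∀ i, c i = 0 → i + 1 ∉ S := fun i hi h => by
    simpa [(hzero i hi).2] using hok _ h
  have hall : ∀ i, i ∈ S := forall_of_forall_sub_one (fun i hi => by
    obtain ⟨h0, hadd | hsub⟩ | ⟨-, -, hsub⟩ := hletter i hi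
    · exact absurd hadd (hne i h0)
    · exact hsub
    · exact hsub) hi₀
  refine hc (funext fun i => ?_)
  obtain ⟨h0, -⟩ | ⟨h1, -⟩ := hletter i (hall i)
  · exact absurd (hall (i + 1)) (hne i h0)
  · exact h1

/-- The letters of `c` before position `i` end in a `0` followed by letters `1`. -/
inductive Pending (c : ZMod n → Fin 3) : ZMod n → Prop
  | zero {i : ZMod n} (hi : c i = 0) : Pending c (i + 1)
  | one {i : ZMod n} (hi : c i = 1) (h : Pending c i) : Pending c (i + 1)

theorem pending_add_one_iff {i : ZMod n} :
    Pending c (i + 1) ↔ c i = 0 ∨ (c i = 1 ∧ Pending c i) := by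
  refine ⟨fun h => ?_, fun h => h.elim .zero fun h => .one h.1 h.2⟩
  generalize hj : i + 1 = j at h
  cases h with
  | zero hi => exact .inl (add_right_cancel hj ▸ hi)
  | one hi h =>
    obtain rfl := add_right_cancel hj
    exact .inr ⟨hi, h⟩

theorem Pending.exists_lt_cyclicDegree {i : ZMod n} (h : Pending c i) :
    ∃ S : Finset (ZMod n), i ∈ S ∧ i - 1 ∈ S ∧ ∀ j ∈ S, j ≠ i → (c j : ℕ) < cyclicDegree S j := by
  induction h with
  | @zero i hi =>
    refine ⟨{i + 1, i}, by simp, by simp, fun j hj hne => ?_⟩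
    obtain rfl : j = i := by simpa [hne] using hj
    simp [cyclicDegree, hi]
  | @one i hi h ih =>
    obtain ⟨S, hiS, hsub, hS⟩ := ih
    refine ⟨insert (i + 1) S, by simp, by simp [hiS], fun j hj hne => ?_⟩
    obtain rfl | hji := eq_or_ne j i
    · simp [cyclicDegree, hi, hsub]
    · exact (hS j (Finset.mem_of_mem_insert_of_ne hj hne) hji).trans_le
        (cyclicDegree_mono (Finset.subset_insert _ _) j)

theorem IsRecurrentWord.not_pending (hc : IsRecurrentWord c) {i : ZMod n} (hi : c i = 0) :
    ¬Pending c i := by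
  intro h
  obtain ⟨S, hiS, hsub, hS⟩ := h.exists_lt_cyclicDegree
  obtain ⟨j, hj, hle⟩ := hc S ⟨i, hiS⟩
  obtain rfl | hne := eq_or_ne j i
  · simp [cyclicDegree, hi, hsub] at hle
  · exact (hS j hj hne).not_ge hle

theorem IsRecurrentWord.exists_isTrack (hc : IsRecurrentWord c) : ∃ σ, IsTrack c σ := by
  classical
  refine ⟨fun i => if Pending c i then 0 else 1, fun i => ?_⟩
  simp only [pending_add_one_iff]
  generalize hci : c i = a
  fin_cases a
  · simp [Step, hc.not_pending hci]
  · simp [Step]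
  · simp [Step]

theorem IsRecurrentWord.ne_one [NeZero n] (hc : IsRecurrentWord c) : c ≠ 1 := by
  rintro rfl
  obtain ⟨i, -, h⟩ := hc Finset.univ Finset.univ_nonempty
  simp [cyclicDegree] at h

end Words

section TransferMatrix

variable {S R : Type*} [Fintype S] [DecidableEq S] [CommSemiring R]

theorem sum_prod_map_range_apply_mul (M : ℕ → Matrix S S R) (k : ℕ) (f : S → S → R) :
    ∑ a, ∑ b, ((List.range k).map M).prod a b * f a b =
      ∑ σ : Fin (k + 1) → S,
        (∏ i : Fin k, M i (σ i.castSucc) (σ i.succ)) * f (σ 0) (σ (Fin.last k)) := by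
  induction k generalizing f with
  | zero =>
    rw [← (Equiv.funUnique (Fin 1) S).symm.sum_comp]
    simp [Matrix.one_apply]
  | succ k ih =>
    rw [← (Fin.snocEquiv fun _ => S).sum_comp, Fintype.sum_prod_type_right]
    simp only [Fin.snocEquiv, Equiv.coe_fn_mk, Fin.prod_univ_castSucc, Fin.snoc_castSucc,
      Fin.succ_last, Fin.snoc_last, Fin.succ_castSucc, Fin.val_castSucc, Fin.val_last, mul_assoc]
    have h0 : ∀ (x : S) (σ : Fin (k + 1) → S),
        (Fin.snoc σ x : Fin (k + 2) → S) 0 = σ 0 :=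
      fun x σ => Fin.snoc_castSucc (α := fun _ => S) x σ 0
    simp only [h0, ← Finset.mul_sum]
    rw [← ih fun a b => ∑ x, M k b x * f a x]
    simp only [List.range_succ, List.map_append, List.map_cons, List.map_nil, List.prod_append,
      List.prod_singleton, Matrix.mul_apply, Finset.sum_mul, Finset.mul_sum, mul_assoc]
    exact Finset.sum_congr rfl fun a _ => Finset.sum_comm

theorem trace_prod_map_range {n : ℕ} [NeZero n] (M : ℕ → Matrix S S R) :
    ((List.range n).map M).prod.trace =
      ∑ σ : ZMod n → S, ∏ i, M i.val (σ i) (σ (i + 1)) := by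
  obtain ⟨k, rfl⟩ := Nat.exists_eq_succ_of_ne_zero (NeZero.ne n)
  change _ = ∑ σ : Fin (k + 1) → S, ∏ i : Fin (k + 1), M i (σ i) (σ (i + 1))
  simp only [Fin.prod_univ_castSucc, Fin.coeSucc_eq_succ, Fin.last_add_one, Fin.val_castSucc,
    Fin.val_last]
  rw [← sum_prod_map_range_apply_mul M k fun a b => M k b a, List.range_succ, List.map_append,
    List.prod_append, List.map_singleton, List.prod_singleton]
  simp only [Matrix.trace, Matrix.diag_apply, Matrix.mul_apply]

end TransferMatrix

section Counting

variable {n : ℕ} [NeZero n]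

/-- The transfer matrix of the letter `a`: the adjacency matrix of the transitions `Step a`. -/
def letterMatrix (a : Fin 3) : Matrix (Fin 2) (Fin 2) ℤ :=
  Matrix.of fun s u => if Step a s u then 1 else 0

theorem card_isTrack_one : (Finset.univ.filter (IsTrack (1 : ZMod n → Fin 3))).card = 2 := by
  have hconst : Finset.univ.filter (IsTrack (1 : ZMod n → Fin 3)) =
      Finset.univ.image fun s : Fin 2 => fun _ => s := by
    ext σ
    have hone : ∀ i, Step ((1 : ZMod n → Fin 3) i) (σ i) (σ (i + 1)) ↔ σ (i + 1) = σ i := by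
      simp [Step]
    simp only [Finset.mem_filter, Finset.mem_univ, true_and, Finset.mem_image, IsTrack, hone]
    refine ⟨fun h => ⟨σ 0, funext fun i => ?_⟩, ?_⟩
    · exact (forall_of_forall_add_one (P := fun i => σ i = σ 0)
        (fun i hi => (h i).trans hi) rfl i).symm
    · rintro ⟨s, rfl⟩ i
      rfl
  rw [hconst, Finset.card_image_of_injective _ fun s u h => congr_fun h 0, Finset.card_univ,
    Fintype.card_fin]

instance : DecidablePred (IsRecurrentWord (n := n)) :=
  fun c => inferInstanceAs
    (Decidable (∀ S : Finset (ZMod n), S.Nonempty → ∃ i ∈ S, cyclicDegree S i ≤ (c i : ℕ)))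

theorem card_isTrack (c : ZMod n → Fin 3) :
    (Finset.univ.filter (IsTrack c)).card =
      (if IsRecurrentWord c then 1 else 0) + if c = 1 then 2 else 0 := by
  obtain rfl | hc := eq_or_ne c 1
  · have hnot : ¬IsRecurrentWord (1 : ZMod n → Fin 3) := fun h => h.ne_one rfl
    rw [card_isTrack_one, if_neg hnot, if_pos rfl]
  rw [if_neg hc, add_zero]
  split_ifs with h
  · obtain ⟨σ, hσ⟩ := h.exists_isTrack
    refine Finset.card_eq_one.2 ⟨σ, Finset.eq_singleton_iff_unique_mem.2 ⟨by simpa, ?_⟩⟩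
    intro τ hτ
    by_contra hne
    obtain ⟨i, hi⟩ := Function.ne_iff.1 hne
    exact hc (IsTrack.eq_one_of_ne (Finset.mem_filter.1 hτ).2 hσ hi)
  · rw [Finset.card_eq_zero, Finset.filter_eq_empty_iff]
    exact fun σ _ hσ => h (hσ.isRecurrentWord hc)

theorem sum_prod_letterMatrix (c : ZMod n → Fin 3) :
    ∑ σ : ZMod n → Fin 2, ∏ i, letterMatrix (c i) (σ i) (σ (i + 1)) =
      (Finset.univ.filter (IsTrack c)).card := by
  rw [Finset.natCast_card_filter]
  refine Finset.sum_congr rfl fun σ _ => ?_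
  simp only [letterMatrix, Matrix.of_apply, Finset.prod_boole, Finset.mem_univ, true_imp_iff]
  rfl

/-- Every recurrent word has one track; the word `1` is not recurrent and has two. -/
theorem card_isRecurrentWord_add (L : ℕ → Finset (Fin 3)) :
    ((Finset.univ.filter fun c : ZMod n → Fin 3 =>
        IsRecurrentWord c ∧ ∀ t < n, c t ∈ L t).card : ℤ) + (if ∀ t < n, 1 ∈ L t then 2 else 0) =
      ((List.range n).map fun t => ∑ a ∈ L t, letterMatrix a).prod.trace := by
  have hmem : ∀ c : ZMod n → Fin 3,
      c ∈ Fintype.piFinset (fun i : ZMod n => L i.val) ↔ ∀ t < n, c t ∈ L t := fun c => by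
    rw [Fintype.mem_piFinset]
    refine ⟨fun h t ht => by simpa [ZMod.val_natCast_of_lt ht] using h t, fun h i => ?_⟩
    simpa using h i.val (ZMod.val_lt i)
  rw [trace_prod_map_range]
  simp only [Matrix.sum_apply, Finset.prod_univ_sum]
  rw [Finset.sum_comm]
  simp only [sum_prod_letterMatrix, card_isTrack, Nat.cast_add, Finset.sum_add_distrib]
  congr 1
  · rw [← Nat.cast_sum, ← Finset.card_filter]
    congr 2
    ext c
    simp [hmem, and_comm]
  · rw [← Nat.cast_sum, Finset.sum_ite_eq']
    simp only [hmem, Pi.one_apply, Nat.cast_ite, Nat.cast_ofNat, Nat.cast_zero]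

theorem fib_two_mul_succ (r : ℕ) : (Nat.fib (2 * (r + 1)) : ℤ) =
    Nat.fib (2 * r) + Nat.fib (2 * r + 1) := by
  exact_mod_cast Nat.fib_add_two (n := 2 * r)

theorem fib_two_mul_succ_add_one (r : ℕ) : (Nat.fib (2 * (r + 1) + 1) : ℤ) =
    Nat.fib (2 * r) + 2 * Nat.fib (2 * r + 1) := by
  have h : Nat.fib (2 * (r + 1) + 1) = Nat.fib (2 * r + 1) + Nat.fib (2 * (r + 1)) :=
    Nat.fib_add_two (n := 2 * r + 1)
  rw [h, Nat.cast_add, fib_two_mul_succ]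
  ring

theorem letterMatrix_two : letterMatrix 2 = !![0, 1; 0, 1] := by decide

theorem sum_zero_one_letterMatrix :
    ∑ a ∈ ({0, 1} : Finset (Fin 3)), letterMatrix a = !![1, 0; 1, 1] := by decide

theorem sum_letterMatrix : ∑ a, letterMatrix a = !![1, 1; 1, 2] := by decide

theorem sum_letterMatrix_pow (r : ℕ) : (∑ a, letterMatrix a) ^ r =
    !![(Nat.fib (2 * r + 1) - Nat.fib (2 * r) : ℤ), (Nat.fib (2 * r) : ℤ);
      (Nat.fib (2 * r) : ℤ), (Nat.fib (2 * r + 1) : ℤ)] := by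
  induction r with
  | zero => simp [Matrix.one_fin_two]
  | succ r ih =>
    rw [pow_succ, ih, sum_letterMatrix, Matrix.mul_fin_two, fib_two_mul_succ,
      fib_two_mul_succ_add_one]
    ext i j
    fin_cases i <;> fin_cases j <;> simp <;> ring

theorem mem_zero_one_iff {a : Fin 3} : a ∈ ({0, 1} : Finset (Fin 3)) ↔ a ≠ 2 := by
  revert a
  decide

theorem card_isRecurrentWord_apply_zero_ne_two :
    ((Finset.univ.filter fun c : ZMod n → Fin 3 => IsRecurrentWord c ∧ c 0 ≠ 2).card : ℤ) =
      2 * (Nat.fib (2 * n - 1) - 1) := by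
  obtain ⟨r, rfl⟩ := Nat.exists_eq_succ_of_ne_zero (NeZero.ne n)
  let L : ℕ → Finset (Fin 3) := fun t => if t = 0 then {0, 1} else Finset.univ
  have hL : ∀ c : ZMod (r + 1) → Fin 3, (∀ t < r + 1, c t ∈ L t) ↔ c 0 ≠ 2 := fun c => by
    refine ⟨fun h => mem_zero_one_iff.1 (by simpa [L] using h 0 r.succ_pos), fun h t _ => ?_⟩
    obtain rfl | ht := eq_or_ne t 0
    · simpa [L] using mem_zero_one_iff.2 h
    · simp [L, ht]
  have hone : ∀ t < r + 1, 1 ∈ L t := fun t _ => by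
    simp only [L]
    split_ifs <;> decide
  have hprod : ((List.range (r + 1)).map fun t => ∑ a ∈ L t, letterMatrix a).prod =
      (∑ a ∈ ({0, 1} : Finset (Fin 3)), letterMatrix a) * (∑ a, letterMatrix a) ^ r := by
    simp [List.range_succ_eq_map, L, Function.comp_def]
  have hcard := card_isRecurrentWord_add (n := r + 1) L
  simp only [hL] at hcard
  rw [if_pos hone, hprod, sum_zero_one_letterMatrix, sum_letterMatrix_pow, Matrix.mul_fin_two,
    Matrix.trace_fin_two_of] at hcard
  have hsub : 2 * r.succ - 1 = 2 * r + 1 := by lia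
  rw [hsub]
  linarith

/-- The letters allowed at position `t` in a word whose letters `2` at the positions `1, …, m` form
a maximal block. -/
def arcLetters (m t : ℕ) : Finset (Fin 3) :=
  if t = 0 ∨ t = 1 + m then {0, 1} else if t ≤ m then {2} else Finset.univ

omit [NeZero n] in
theorem forall_mem_arcLetters_iff {m : ℕ} (hmn : m + 2 ≤ n) {c : ZMod n → Fin 3} :
    (∀ t < n, c t ∈ arcLetters m t) ↔
      c 0 ≠ 2 ∧ (∀ t < m, c (1 + t) = 2) ∧ c (1 + m) ≠ 2 := by
  refine ⟨fun h => ⟨?_, fun t ht => ?_, ?_⟩, fun ⟨h0, harc, hend⟩ t _ => ?_⟩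
  · exact mem_zero_one_iff.1 (by simpa [arcLetters] using h 0 (by lia))
  · simpa [arcLetters, ht.ne, Nat.one_add_le_iff, ht] using h (1 + t) (by lia)
  · exact mem_zero_one_iff.1 (by simpa [arcLetters] using h (1 + m) (by lia))
  · unfold arcLetters
    split_ifs with hends hle
    · obtain rfl | rfl := hends
      · simpa using mem_zero_one_iff.2 h0
      · simpa using mem_zero_one_iff.2 hend
    · obtain ⟨u, rfl⟩ : ∃ u, t = 1 + u := ⟨t - 1, by lia⟩
      simpa using harc u (by lia)
    · exact Finset.mem_univ _

theorem prod_sum_arcLetters {m : ℕ} (hm : m ≠ 0) (r : ℕ) :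
    ((List.range (1 + (m + (1 + r)))).map fun t => ∑ a ∈ arcLetters m t, letterMatrix a).prod =
      !![1, 0; 1, 1] * (!![0, 1; 0, 1] * (!![1, 0; 1, 1] * (∑ a, letterMatrix a) ^ r)) := by
  have hblock : (List.range m).map (fun t => ∑ a ∈ arcLetters m (1 + t), letterMatrix a) =
      List.replicate m (letterMatrix 2) := by
    refine List.eq_replicate_iff.2 ⟨by simp, fun M hM => ?_⟩
    obtain ⟨t, ht, rfl⟩ := List.mem_map.1 hM
    rw [List.mem_range] at ht
    simp [arcLetters, ht.ne, Nat.one_add_le_iff, ht]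
  have htail : (fun t => ∑ a ∈ arcLetters m (1 + (m + (1 + t))), letterMatrix a) =
      fun _ => ∑ a, letterMatrix a := by
    funext t
    rw [arcLetters, if_neg (by lia), if_neg (by lia)]
  have hidem : IsIdempotentElem (letterMatrix 2) := by
    unfold IsIdempotentElem
    decide
  rw [← sum_zero_one_letterMatrix, ← letterMatrix_two, ← hidem.pow_eq hm]
  simp only [List.range_add, List.range_one, List.map_append, List.map_map, List.map_cons,
    List.map_nil, Function.comp_def, List.prod_append, List.prod_singleton, hblock, htail,
    List.prod_replicate, List.map_const', List.length_range]
  simp [arcLetters]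

theorem card_isRecurrentWord_arc_one {m : ℕ} (hm : 1 ≤ m) (hmn : m + 2 ≤ n) :
    ((Finset.univ.filter fun c : ZMod n → Fin 3 =>
      IsRecurrentWord c ∧ c 0 ≠ 2 ∧ (∀ t < m, c (1 + t) = 2) ∧ c (1 + m) ≠ 2).card : ℤ) =
      Nat.fib (2 * (n - m)) := by
  obtain ⟨r, rfl⟩ : ∃ r, n = 1 + (m + (1 + r)) := ⟨n - m - 2, by lia⟩
  have hone : ¬∀ t < 1 + (m + (1 + r)), 1 ∈ arcLetters m t := fun h => by
    have := h 1 (by lia)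
    simp [arcLetters, hm, Nat.one_le_iff_ne_zero.1 hm] at this
  have hcard := card_isRecurrentWord_add (n := 1 + (m + (1 + r))) (arcLetters m)
  simp only [forall_mem_arcLetters_iff hmn] at hcard
  rw [if_neg hone, add_zero, prod_sum_arcLetters (Nat.one_le_iff_ne_zero.1 hm),
    sum_letterMatrix_pow, Matrix.mul_fin_two, Matrix.mul_fin_two, Matrix.mul_fin_two,
    Matrix.trace_fin_two_of] at hcard
  have hsub : 1 + (m + (1 + r)) - m = r + 1 + 1 := by lia
  rw [hcard, hsub, fib_two_mul_succ, fib_two_mul_succ, fib_two_mul_succ_add_one]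
  ring

end Counting

section Arcs

variable {n : ℕ} {p : ZMod n → Prop}

/-- `i, i + 1, …, i + m - 1` is a maximal block of consecutive elements of `ZMod n` satisfying `p`;
both `i - 1` and `i + m` fail `p`, which forces `m < n`. -/
def IsMaximalArc (p : ZMod n → Prop) (i : ZMod n) (m : ℕ) : Prop :=
  ¬p (i - 1) ∧ (∀ t < m, p (i + t)) ∧ ¬p (i + m)

instance [DecidablePred p] (i : ZMod n) : DecidablePred (IsMaximalArc p i) :=
  fun m => inferInstanceAs (Decidable (¬p (i - 1) ∧ (∀ t < m, p (i + t)) ∧ ¬p (i + m)))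

theorem IsMaximalArc.length_lt [NeZero n] {i : ZMod n} {m : ℕ} (h : IsMaximalArc p i m) :
    m < n := by
  by_contra! hn
  refine h.1 ?_
  have hpos := NeZero.pos n
  have := h.2.1 (n - 1) (by lia)
  rwa [Nat.cast_sub hpos, ZMod.natCast_self, Nat.cast_one, zero_sub, ← sub_eq_add_neg] at this

theorem IsMaximalArc.offset_le {i i' : ZMod n} {m m' j j' : ℕ} (h : IsMaximalArc p i m)
    (h' : IsMaximalArc p i' m') (hj' : j' < m') (heq : i + j = i' + j') : j' ≤ j := by
  by_contra! hlt
  obtain ⟨d, rfl⟩ := Nat.exists_eq_add_of_lt hlt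
  refine h.1 ?_
  have hi : i - 1 = i' + d := by
    push_cast at heq
    linear_combination heq
  exact hi ▸ h'.2.1 d (by lia)

theorem IsMaximalArc.length_le {i : ZMod n} {m m' : ℕ} (h : IsMaximalArc p i m)
    (h' : IsMaximalArc p i m') : m' ≤ m := by
  by_contra! hlt
  exact h.2.2 (h'.2.1 m hlt)

theorem exists_isMaximalArc [NeZero n] {k l : ZMod n} (hk : p k) (hl : ¬p l) :
    ∃ (i : ZMod n) (m j : ℕ), IsMaximalArc p i m ∧ j < m ∧ i + j = k := by
  classical
  have hleft : ∃ t : ℕ, ¬p (k - t) := ⟨(k - l).val, by simpa⟩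
  have hright : ∃ t : ℕ, ¬p (k + t) := ⟨(l - k).val, by simpa⟩
  obtain ⟨a, ha⟩ : ∃ a, Nat.find hleft = a + 1 :=
    Nat.exists_eq_succ_of_ne_zero fun h => by simpa [h, hk] using Nat.find_spec hleft
  have hb : 0 < Nat.find hright :=
    Nat.pos_of_ne_zero fun h => by simpa [h, hk] using Nat.find_spec hright
  refine ⟨k - a, a + Nat.find hright, a, ⟨?_, fun t ht => ?_, ?_⟩, by lia, by ring⟩
  · have := Nat.find_spec hleft
    rw [ha] at this
    convert this using 2
    push_cast
    ring
  · obtain hta | hta := lt_or_ge t a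
    · have := not_not.1 (Nat.find_min hleft (m := a - t) (by lia))
      rw [Nat.cast_sub hta.le] at this
      convert this using 1
      ring
    · have := not_not.1 (Nat.find_min hright (m := t - a) (by lia))
      rw [Nat.cast_sub hta] at this
      convert this using 1
      ring
  · have := Nat.find_spec hright
    convert this using 2
    push_cast
    ring

theorem sum_filter_eq_sum_isMaximalArc [NeZero n] [DecidablePred p] {M : Type*} [AddCommMonoid M]
    {l : ZMod n} (hl : ¬p l) (f : ZMod n → M) :
    ∑ k with p k, f k =
      ∑ m ∈ Finset.Icc 1 (n - 1), ∑ i with IsMaximalArc p i m, ∑ j ∈ Finset.range m, f (i + j) := by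
  rw [Finset.sum_sigma', Finset.sum_sigma']
  symm
  refine Finset.sum_bij (fun x _ => x.1.2 + x.2) ?_ ?_ ?_ fun _ _ => rfl
  · rintro ⟨⟨m, i⟩, j⟩ h
    simp only [Finset.mem_sigma, Finset.mem_filter, Finset.mem_univ, true_and,
      Finset.mem_range] at h ⊢
    exact h.1.2.2.1 j h.2
  · rintro ⟨⟨m, i⟩, j⟩ h ⟨⟨m', i'⟩, j'⟩ h' heq
    simp only [Finset.mem_sigma, Finset.mem_filter, Finset.mem_univ, true_and,
      Finset.mem_range] at h h' heq
    obtain rfl : j = j' := (h'.1.2.offset_le h.1.2 h.2 heq.symm).antisymm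
      (h.1.2.offset_le h'.1.2 h'.2 heq)
    obtain rfl := add_right_cancel heq
    obtain rfl : m = m' := (h'.1.2.length_le h.1.2).antisymm (h.1.2.length_le h'.1.2)
    rfl
  · intro k hk
    obtain ⟨i, m, j, harc, hj, rfl⟩ := exists_isMaximalArc (Finset.mem_filter.1 hk).2 hl
    have := harc.length_lt
    refine ⟨⟨⟨m, i⟩, j⟩, ?_, rfl⟩
    simp only [Finset.mem_sigma, Finset.mem_filter, Finset.mem_univ, true_and, Finset.mem_range,
      Finset.mem_Icc]
    exact ⟨⟨by lia, harc⟩, hj⟩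

/-- The block `i, i + 1, …, i + m - 1` of consecutive elements of `ZMod n`. -/
def arc (i : ZMod n) (m : ℕ) : Finset (ZMod n) :=
  (Finset.range m).image fun t : ℕ => i + t

theorem mem_arc {i q : ZMod n} {m : ℕ} : q ∈ arc i m ↔ ∃ t < m, i + t = q := by
  simp only [arc, Finset.mem_image, Finset.mem_range]

theorem prod_arc {M : Type*} [CommMonoid M] (i : ZMod n) {m : ℕ} (hm : m ≤ n) (f : ZMod n → M) :
    ∏ q ∈ arc i m, f q = ∏ t ∈ Finset.range m, f (i + t) := by
  refine Finset.prod_image fun t ht u hu h => ?_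
  rw [Finset.mem_coe, Finset.mem_range] at ht hu
  rwa [add_right_inj, ZMod.natCast_eq_natCast_iff', Nat.mod_eq_of_lt (ht.trans_le hm),
    Nat.mod_eq_of_lt (hu.trans_le hm)] at h

theorem eq_sub_one_of_add_one_mem_arc {i q : ZMod n} {m : ℕ} (hq : q ∉ arc i m)
    (h : q + 1 ∈ arc i m) : q = i - 1 := by
  obtain ⟨_ | t, ht, heq⟩ := mem_arc.1 h
  · push_cast at heq
    linear_combination -heq
  · refine absurd (mem_arc.2 ⟨t, by lia, ?_⟩) hq
    push_cast at heq
    linear_combination heq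

theorem eq_add_of_sub_one_mem_arc {i q : ZMod n} {m : ℕ} (hq : q ∉ arc i m)
    (h : q - 1 ∈ arc i m) : q = i + m := by
  obtain ⟨t, ht, heq⟩ := mem_arc.1 h
  have hsucc : i + (t + 1 : ℕ) = q := by
    push_cast
    linear_combination heq
  obtain hlt | rfl : t + 1 < m ∨ m = t + 1 := by lia
  · exact absurd (mem_arc.2 ⟨t + 1, hlt, hsucc⟩) hq
  · exact hsucc.symm

theorem arc_subset_of_closed {i : ZMod n} {m : ℕ} {S : Finset (ZMod n)} (hS : S ⊆ arc i m)
    (hne : S.Nonempty) (hadd : ∀ q ∈ S, q + 1 ∈ arc i m → q + 1 ∈ S)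
    (hsub : ∀ q ∈ S, q - 1 ∈ arc i m → q - 1 ∈ S) : arc i m ⊆ S := by
  obtain ⟨q, hq⟩ := hne
  obtain ⟨u, hu, rfl⟩ := mem_arc.1 (hS hq)
  have hup : ∀ t ≥ u, t < m → i + (t : ZMod n) ∈ S := fun t hut => by
    induction t, hut using Nat.le_induction with
    | base => exact fun _ => hq
    | succ t _ ih =>
      intro ht
      have := hadd _ (ih (by lia))
      rw [add_assoc, ← Nat.cast_succ] at this
      exact this (mem_arc.2 ⟨t + 1, ht, rfl⟩)
  have hdown : ∀ t ≤ u, i + (t : ZMod n) ∈ S := fun t htu => by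
    induction htu using Nat.decreasingInduction with
    | self => exact hq
    | of_succ t ht ih =>
      have := hsub _ ih
      rw [Nat.cast_succ, ← add_assoc, add_sub_cancel_right] at this
      exact this (mem_arc.2 ⟨t, by lia, rfl⟩)
  intro q hq
  obtain ⟨t, ht, rfl⟩ := mem_arc.1 hq
  exact (le_total t u).elim (hdown t) fun h => hup t h ht

end Arcs

section FullWords

variable {n : ℕ}

/-- At most one letter of `c` differs from `2`, and it is a `1`: adding a grain at a letter `2` of
such a word makes every vertex of the rim topple. -/
def IsFull (c : ZMod n → Fin 3) : Prop :=
  ∃ j, (∀ i ≠ j, c i = 2) ∧ c j ≠ 0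

instance [NeZero n] : DecidablePred (IsFull (n := n)) :=
  fun c => inferInstanceAs (Decidable (∃ j, (∀ i ≠ j, c i = 2) ∧ c j ≠ 0))

theorem IsMaximalArc.not_isFull {c : ZMod n → Fin 3} {i : ZMod n} {m : ℕ}
    (h : IsMaximalArc (c · = 2) i m) (hmn : m + 2 ≤ n) : ¬IsFull c := by
  rintro ⟨j, hj, -⟩
  have hstart : i - 1 = j := by_contra fun hne => h.1 (hj _ hne)
  have hend : i + m = j := by_contra fun hne => h.2.2 (hj _ hne)
  have hzero : ((m + 1 : ℕ) : ZMod n) = 0 := by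
    push_cast
    linear_combination hend - hstart
  have := Nat.le_of_dvd m.succ_pos ((ZMod.natCast_eq_zero_iff _ _).1 hzero)
  lia

theorem filter_isFull [NeZero n] : Finset.univ.filter (IsFull (n := n)) =
    insert (2 : ZMod n → Fin 3)
      (Finset.univ.image fun j => Function.update (2 : ZMod n → Fin 3) j 1) := by
  have hletter : ∀ a : Fin 3, a ≠ 0 ↔ a = 2 ∨ a = 1 := by decide
  ext c
  simp only [IsFull, hletter, Finset.mem_filter, Finset.mem_univ, true_and, Finset.mem_insert,
    Finset.mem_image, eq_comm (b := c), Function.eq_update_iff]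
  constructor
  · rintro ⟨j, hj, h2 | h1⟩
    · left
      funext i
      obtain rfl | hij := eq_or_ne i j
      · exact h2
      · exact hj i hij
    · exact .inr ⟨j, h1, hj⟩
  · rintro (rfl | ⟨j, h1, hj⟩)
    · exact ⟨0, fun _ _ => rfl, .inl rfl⟩
    · exact ⟨j, hj, .inr h1⟩

theorem sum_card_isFull [NeZero n] :
    ∑ c : ZMod n → Fin 3 with IsFull c, (Finset.univ.filter (c · = 2)).card = n ^ 2 := by
  have hupdate : ∀ j : ZMod n, Finset.univ.filter
      (Function.update (2 : ZMod n → Fin 3) j 1 · = 2) = Finset.univ.erase j := fun j => by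
    ext k
    obtain rfl | hkj := eq_or_ne k j
    · simp
    · simp [hkj]
  have hinj : Function.Injective fun j => Function.update (2 : ZMod n → Fin 3) j 1 :=
    fun j j' h => by
    by_contra hne
    simpa [hne] using congr_fun h j
  rw [filter_isFull, Finset.sum_insert, Finset.sum_image hinj.injOn]
  · have htwo : Finset.univ.filter ((2 : ZMod n → Fin 3) · = 2) = Finset.univ := by simp
    simp only [htwo, hupdate, Finset.card_erase_of_mem, Finset.mem_univ, Finset.card_univ,
      ZMod.card, Finset.sum_const, smul_eq_mul]
    obtain ⟨r, hr⟩ := Nat.exists_eq_add_one_of_ne_zero (NeZero.ne n)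
    rw [hr, Nat.add_sub_cancel]
    ring
  · rw [Finset.mem_image]
    rintro ⟨j, -, hj⟩
    simpa using congr_fun hj j

variable [Fact (1 < n)]

theorem IsFull.isRecurrentWord {c : ZMod n → Fin 3} (hc : IsFull c) :
    IsRecurrentWord c := by
  obtain ⟨j, hj, -⟩ := hc
  exact isRecurrentWord_of_forall_ne hj

theorem sum_isRecurrentWord_eq_add {M : Type*} [AddCommMonoid M]
    (f : (ZMod n → Fin 3) → M) :
    ∑ c with IsRecurrentWord c, f c =
      ∑ c with IsFull c, f c + ∑ c with IsRecurrentWord c ∧ ¬IsFull c, f c := by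
  have hfull : ∀ c : ZMod n → Fin 3, IsRecurrentWord c ∧ IsFull c ↔ IsFull c := fun _ =>
    and_iff_right_of_imp IsFull.isRecurrentWord
  rw [← Finset.sum_filter_add_sum_filter_not _ IsFull, Finset.filter_filter, Finset.filter_filter]
  simp only [hfull]

theorem isMaximalArc_pred_iff {c : ZMod n → Fin 3} {i : ZMod n} :
    IsMaximalArc (c · = 2) i (n - 1) ↔ c (i - 1) ≠ 2 ∧ ∀ k ≠ i - 1, c k = 2 := by
  have hpos := NeZero.pos n
  have hend : i + (n - 1 : ℕ) = i - 1 := by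
    rw [Nat.cast_sub hpos, ZMod.natCast_self, Nat.cast_one]
    ring
  refine ⟨fun h => ⟨h.1, fun k hk => ?_⟩, fun ⟨h, h2⟩ => ⟨h, fun t ht => h2 _ fun heq => ?_, ?_⟩⟩
  · have hlt : (k - i).val < n - 1 := by
      refine lt_of_le_of_ne (Nat.le_sub_one_of_lt (ZMod.val_lt _)) fun heq => hk ?_
      rw [← hend, ← heq]
      simp
    simpa using h.2.1 _ hlt
  · rw [← hend, add_right_inj, ZMod.natCast_eq_natCast_iff', Nat.mod_eq_of_lt (by lia),
      Nat.mod_eq_of_lt (by lia)] at heq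
    exact ht.ne heq
  · rwa [hend]

theorem IsMaximalArc.add_cyclicDegree_arc_lt {w : ZMod n → Fin 3} {i q : ZMod n}
    {m : ℕ} (h : IsMaximalArc (w · = 2) i m) (hw : ¬IsFull w) (hq : q ∉ arc i m) :
    (w q : ℕ) + cyclicDegree (arc i m) q < 3 := by
  have hstart : q + 1 ∈ arc i m → q = i - 1 := eq_sub_one_of_add_one_mem_arc hq
  have hend : q - 1 ∈ arc i m → q = i + m := eq_add_of_sub_one_mem_arc hq
  have hletter : q = i - 1 ∨ q = i + m → (w q : ℕ) ≠ 2 := by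
    rintro (rfl | rfl) heq
    · exact h.1 (Fin.ext heq)
    · exact h.2.2 (Fin.ext heq)
  have hboth : q = i - 1 → q = i + m → w q = 0 := fun hqs hqe => by
    have hzero : ((m + 1 : ℕ) : ZMod n) = 0 := by
      push_cast
      linear_combination hqs - hqe
    have hle := Nat.le_of_dvd m.succ_pos ((ZMod.natCast_eq_zero_iff _ _).1 hzero)
    obtain rfl : m = n - 1 := by
      have := h.length_lt
      lia
    exact by_contra fun h0 => hw ⟨q, hqs ▸ (isMaximalArc_pred_iff.1 h).2, h0⟩
  have := (w q).isLt
  grind [cyclicDegree]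

end FullWords

section CountingArcs

variable {n : ℕ}

theorem card_isRecurrentWord_comp_add_right [NeZero n] (P : (ZMod n → Fin 3) → Prop)
    [DecidablePred P] (a : ZMod n) :
    (Finset.univ.filter fun c : ZMod n → Fin 3 =>
      IsRecurrentWord c ∧ P fun i => c (i + a)).card =
      (Finset.univ.filter fun c : ZMod n → Fin 3 => IsRecurrentWord c ∧ P c).card := by
  refine Finset.card_equiv ((Equiv.addRight (-a)).arrowCongr (Equiv.refl (Fin 3))) fun c => ?_
  have : (Equiv.addRight (-a)).arrowCongr (Equiv.refl (Fin 3)) c = fun i => c (i + a) := by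
    funext i
    simp [Equiv.arrowCongr]
  simp only [this, Finset.mem_filter, Finset.mem_univ, true_and, isRecurrentWord_comp_add_right_iff]

theorem card_isRecurrentWord_apply_ne_two [NeZero n] (k : ZMod n) :
    ((Finset.univ.filter fun c : ZMod n → Fin 3 => IsRecurrentWord c ∧ c k ≠ 2).card : ℤ) =
      2 * (Nat.fib (2 * n - 1) - 1) := by
  rw [← card_isRecurrentWord_apply_zero_ne_two,
    ← card_isRecurrentWord_comp_add_right (fun c : ZMod n → Fin 3 => c 0 ≠ 2) k]
  simp only [zero_add]

theorem card_isRecurrentWord_isMaximalArc [NeZero n] {m : ℕ} (hm : 1 ≤ m) (hmn : m + 2 ≤ n)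
    (i : ZMod n) :
    ((Finset.univ.filter fun c : ZMod n → Fin 3 =>
      IsRecurrentWord c ∧ IsMaximalArc (c · = 2) i m).card : ℤ) = Nat.fib (2 * (n - m)) := by
  rw [← card_isRecurrentWord_arc_one hm hmn, ← card_isRecurrentWord_comp_add_right
    (fun c : ZMod n → Fin 3 => c 0 ≠ 2 ∧ (∀ t < m, c (1 + t) = 2) ∧ c (1 + m) ≠ 2) (i - 1)]
  have hadd : ∀ t : ℕ, 1 + (t : ZMod n) + (i - 1) = i + t := fun t => by ring
  congr 2
  ext c
  rw [Finset.mem_filter, Finset.mem_filter]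
  simp only [IsMaximalArc, hadd, zero_add, ne_eq]

theorem card_isRecurrentWord_not_isFull_isMaximalArc [Fact (1 < n)] {m : ℕ} (hm : 1 ≤ m)
    (hmn : m < n) (i : ZMod n) :
    ((Finset.univ.filter fun c : ZMod n → Fin 3 =>
      IsRecurrentWord c ∧ ¬IsFull c ∧ IsMaximalArc (c · = 2) i m).card : ℤ) =
      Nat.fib (2 * (n - m)) := by
  obtain hlt | rfl : m + 2 ≤ n ∨ m = n - 1 := by lia
  · have hnot : ∀ c : ZMod n → Fin 3, ¬IsFull c ∧ IsMaximalArc (c · = 2) i m ↔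
        IsMaximalArc (c · = 2) i m := fun c => and_iff_right_of_imp fun h => h.not_isFull hlt
    simp only [hnot, card_isRecurrentWord_isMaximalArc hm hlt]
  have hsingle : (Finset.univ.filter fun c : ZMod n → Fin 3 =>
      IsRecurrentWord c ∧ ¬IsFull c ∧ IsMaximalArc (c · = 2) i (n - 1)) =
      {Function.update (2 : ZMod n → Fin 3) (i - 1) 0} := by
    ext c
    simp only [Finset.mem_filter, Finset.mem_univ, true_and, Finset.mem_singleton,
      isMaximalArc_pred_iff, Function.eq_update_iff]
    refine ⟨fun ⟨_, hfull, _, h2⟩ => ⟨by_contra fun h0 => hfull ⟨i - 1, h2, h0⟩, h2⟩,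
      fun ⟨h0, h2⟩ => ⟨isRecurrentWord_of_forall_ne h2, ?_, by simp [h0], h2⟩⟩
    rintro ⟨j, hj, hne⟩
    obtain rfl | hij := eq_or_ne (i - 1) j
    · exact hne h0
    · simpa [h0] using hj _ hij
  have hsub : 2 * (n - (n - 1)) = 2 := by lia
  rw [hsingle, hsub]
  simp

end CountingArcs

section Wheel

variable {n : ℕ}

theorem adj_sink (v : {v : Option (Fin n) // v ≠ none}) : (wheelGraph n).Adj v.1 none := by
  obtain ⟨_ | i, hi⟩ := v
  · exact absurd rfl hi
  · trivial

variable [NeZero n]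

/-- The non-sink vertices of the wheel, indexed by the integers modulo `n`. -/
def rimVertex (n : ℕ) [NeZero n] : ZMod n ≃ {v : Option (Fin n) // v ≠ none} where
  toFun i := ⟨some ⟨i.val, ZMod.val_lt i⟩, Option.some_ne_none _⟩
  invFun v := ((v.1.get (Option.isSome_iff_ne_none.2 v.2)).val : ZMod n)
  left_inv i := by simp
  right_inv v := by
    obtain ⟨_ | i, hi⟩ := v
    · exact absurd rfl hi
    · simp [ZMod.val_natCast_of_lt i.2]

theorem wheelGraph_adj_rimVertex (hn : 2 ≤ n) (i j : ZMod n) :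
    (wheelGraph n).Adj (rimVertex n i).1 (rimVertex n j).1 ↔ i = j + 1 ∨ i = j - 1 := by
  obtain ⟨k, rfl⟩ := Nat.exists_eq_add_of_le' hn
  have hadj : (wheelGraph (k + 2)).Adj (rimVertex (k + 2) i).1 (rimVertex (k + 2) j).1 ↔
      i - j = 1 ∨ j - i = 1 := SimpleGraph.cycleGraph_adj
  rw [hadj, sub_eq_iff_eq_add', sub_eq_iff_eq_add', eq_sub_iff_add_eq, eq_comm (a := j)]

theorem degreeIn_map_rimVertex (hn : 3 ≤ n) (T : Finset (ZMod n)) (i : ZMod n) :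
    degreeIn (wheelGraph n) (T.map (rimVertex n).toEmbedding) (rimVertex n i).1 =
      cyclicDegree T i := by
  have hne : i + 1 ≠ i - 1 := fun h => by
    have h2 : ((2 : ℕ) : ZMod n) = 0 := by
      push_cast
      linear_combination h
    have := Nat.le_of_dvd two_pos ((ZMod.natCast_eq_zero_iff _ _).1 h2)
    lia
  have hsplit : ∀ j : ZMod n, (if j = i + 1 ∨ j = i - 1 then 1 else 0) =
      (if j = i + 1 then 1 else 0) + if j = i - 1 then 1 else 0 := fun j => by grind
  rw [degreeIn, Finset.card_filter, Finset.sum_map]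
  simp only [Equiv.coe_toEmbedding, wheelGraph_adj_rimVertex (Nat.le_of_succ_le hn), hsplit,
    Finset.sum_add_distrib, Finset.sum_ite_eq', cyclicDegree]

theorem degree_rimVertex (hn : 3 ≤ n) (i : ZMod n) :
    (wheelGraph n).degree (rimVertex n i).1 = 3 := by
  rw [degree_eq_degreeIn_univ_add, if_pos (adj_sink _), ← Finset.map_univ_equiv (rimVertex n),
    degreeIn_map_rimVertex hn]
  simp [cyclicDegree]

/-- The sandpile on the wheel whose numbers of grains are the letters of the cyclic word `w`. -/
def wordSandpile (w : ZMod n → Fin 3) : Sandpile (none : Option (Fin n)) :=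
  fun v => (w ((rimVertex n).symm v) : ℕ)

@[simp]
theorem wordSandpile_rimVertex (w : ZMod n → Fin 3) (i : ZMod n) :
    wordSandpile w (rimVertex n i) = (w i : ℕ) := by
  rw [wordSandpile, Equiv.symm_apply_apply]

theorem wordSandpile_injective : Function.Injective (wordSandpile (n := n)) := fun w w' h => by
  funext i
  simpa [Fin.ext_iff] using congr_fun h (rimVertex n i)

theorem isStable_iff_exists_wordSandpile (hn : 3 ≤ n) {c : Sandpile (none : Option (Fin n))} :
    IsStable (wheelGraph n) c ↔ ∃ w, wordSandpile w = c := by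
  rw [IsStable, (rimVertex n).surjective.forall]
  simp only [degree_rimVertex hn]
  refine ⟨fun h => ⟨fun i => ⟨c (rimVertex n i), h i⟩, ?_⟩, ?_⟩
  · funext v
    simp [wordSandpile]
  · rintro ⟨w, rfl⟩ i
    rw [wordSandpile_rimVertex]
    exact (w i).2

theorem forall_finset_rimVertex {P : Finset {v : Option (Fin n) // v ≠ none} → Prop} :
    (∀ S, P S) ↔ ∀ S : Finset (ZMod n), P (S.map (rimVertex n).toEmbedding) :=
  (rimVertex n).finsetCongr.surjective.forall

theorem isRecurrent_wordSandpile_iff (hn : 3 ≤ n) (w : ZMod n → Fin 3) :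
    IsRecurrent (wheelGraph n) (wordSandpile w) ↔ IsRecurrentWord w := by
  rw [isRecurrent_iff_of_forall_adj adj_sink,
    and_iff_right ((isStable_iff_exists_wordSandpile hn).2 ⟨w, rfl⟩), forall_finset_rimVertex]
  simp only [IsRecurrentWord, Finset.map_nonempty, Finset.mem_map, Equiv.coe_toEmbedding,
    exists_exists_and_eq_and, degreeIn_map_rimVertex hn, wordSandpile_rimVertex]

theorem sum_recurrents_wheelGraph (hn : 3 ≤ n) {M : Type*} [AddCommMonoid M]
    (F : Sandpile (none : Option (Fin n)) → M) :
    ∑ c ∈ recurrents (wheelGraph n) none, F c =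
      ∑ w : ZMod n → Fin 3 with IsRecurrentWord w, F (wordSandpile w) := by
  have himage : recurrents (wheelGraph n) none =
      (Finset.univ.filter (IsRecurrentWord (n := n))).image wordSandpile := by
    ext c
    simp only [mem_recurrents, Finset.mem_image, Finset.mem_filter, Finset.mem_univ, true_and]
    refine ⟨fun hc => ?_, ?_⟩
    · obtain ⟨w, rfl⟩ := (isStable_iff_exists_wordSandpile hn).1 hc.1
      exact ⟨w, (isRecurrent_wordSandpile_iff hn w).1 hc, rfl⟩
    · rintro ⟨w, hw, rfl⟩
      exact (isRecurrent_wordSandpile_iff hn w).2 hw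
  rw [himage, Finset.sum_image wordSandpile_injective.injOn]

theorem avalancheMonomial_wordSandpile (hn : 3 ≤ n) (w : ZMod n → Fin 3) (k : ZMod n)
    (T : Finset (ZMod n))
    (hT : ∀ S ⊆ T, S.Nonempty →
      ∃ i ∈ S, 3 ≤ (w i : ℕ) + (if i = k then 1 else 0) + cyclicDegree (T \ S) i)
    (hstable : ∀ i, (w i : ℕ) + (if i = k then 1 else 0) + cyclicDegree T i <
      3 + if i ∈ T then 3 else 0) :
    avalancheMonomial (wheelGraph n) (wordSandpile w) (rimVertex n k) =
      ∏ i ∈ T, MvPolynomial.X (rimVertex n i) := by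
  have happly : ∀ i, (wordSandpile w + Pi.single (rimVertex n k) 1 : Sandpile none)
      (rimVertex n i) = (w i : ℕ) + if i = k then 1 else 0 := fun i => by
    simp [Pi.single_apply]
  rw [avalancheMonomial, topplingVector_eq_indicator _ (T.map (rimVertex n).toEmbedding)]
  · simp only [pow_ite, pow_one, pow_zero, Finset.prod_ite_mem, Finset.univ_inter,
      Finset.prod_map, Equiv.coe_toEmbedding]
  · rw [forall_finset_rimVertex]
    intro S hST hS
    rw [Finset.map_subset_map] at hST
    obtain ⟨i, hi, hle⟩ := hT S hST (Finset.map_nonempty.1 hS)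
    refine ⟨rimVertex n i, Finset.mem_map_of_mem _ hi, ?_⟩
    rwa [degree_rimVertex hn, happly, ← Finset.map_sdiff, degreeIn_map_rimVertex hn]
  · rw [(rimVertex n).surjective.forall]
    intro i
    rw [degree_rimVertex hn, happly, degreeIn_map_rimVertex hn]
    simpa using hstable i

theorem avalancheMonomial_of_ne_two (hn : 3 ≤ n) {w : ZMod n → Fin 3} {k : ZMod n} (hk : w k ≠ 2) :
    avalancheMonomial (wheelGraph n) (wordSandpile w) (rimVertex n k) = 1 := by
  rw [avalancheMonomial_wordSandpile hn w k ∅]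
  · exact Finset.prod_empty
  · exact fun S hS hne => absurd (Finset.subset_empty.1 hS) hne.ne_empty
  · intro i
    have hlt := (w i).isLt
    have hne : i = k → (w i : ℕ) ≠ 2 := by
      rintro rfl h
      exact hk (Fin.ext h)
    simp only [cyclicDegree, Finset.notMem_empty, if_false, add_zero]
    split_ifs with hik
    · have := hne hik
      lia
    · exact hlt

theorem IsFull.avalancheMonomial_eq (hn : 3 ≤ n) {w : ZMod n → Fin 3} (hw : IsFull w)
    {k : ZMod n} (hk : w k = 2) :
    avalancheMonomial (wheelGraph n) (wordSandpile w) (rimVertex n k) =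
      ∏ i, MvPolynomial.X (rimVertex n i) := by
  obtain ⟨j, htwo, hj⟩ := hw
  refine avalancheMonomial_wordSandpile hn w k Finset.univ (fun S _ ⟨i, hi⟩ => ?_) fun i => ?_
  · by_contra! hS
    simp only [cyclicDegree, Finset.mem_sdiff, Finset.mem_univ, true_and] at hS
    have hkS : k ∉ S := fun h => by
      have := hS k h
      simp [hk] at this
    have hclosed : ∀ i ∈ S, i ≠ j → i + 1 ∈ S ∧ i - 1 ∈ S := fun i hi hij => by
      have := hS i hi
      rw [htwo i hij] at this
      grind
    have hjS : j ∈ S → j + 1 ∈ S ∨ j - 1 ∈ S := fun h => by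
      have := hS j h
      have : (w j : ℕ) ≠ 0 := fun h => hj (Fin.ext h)
      grind
    by_cases hadd : j ∈ S → j + 1 ∈ S
    · refine hkS (forall_of_forall_add_one (P := (· ∈ S)) (fun i hi => ?_) hi k)
      obtain rfl | hij := eq_or_ne i j
      · exact hadd hi
      · exact (hclosed i hi hij).1
    · refine hkS (forall_of_forall_sub_one (P := (· ∈ S)) (fun i hi => ?_) hi k)
      obtain rfl | hij := eq_or_ne i j
      · exact (hjS hi).resolve_left fun h => hadd fun _ => h
      · exact (hclosed i hi hij).2
  · have := (w i).isLt
    simp only [cyclicDegree, Finset.mem_univ, if_true]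
    split_ifs <;> lia

theorem IsMaximalArc.avalancheMonomial_eq (hn : 3 ≤ n) {w : ZMod n → Fin 3} (hw : ¬IsFull w)
    {i : ZMod n} {m j : ℕ} (h : IsMaximalArc (w · = 2) i m) (hj : j < m) :
    avalancheMonomial (wheelGraph n) (wordSandpile w) (rimVertex n (i + j)) =
      ∏ t ∈ Finset.range m, MvPolynomial.X (rimVertex n (i + t)) := by
  have htwo : ∀ q ∈ arc i m, w q = 2 := fun q hq => by
    obtain ⟨t, ht, rfl⟩ := mem_arc.1 hq
    exact h.2.1 t ht
  have : Fact (1 < n) := ⟨by lia⟩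
  have hk : i + (j : ZMod n) ∈ arc i m := mem_arc.2 ⟨j, hj, rfl⟩
  rw [← prod_arc i h.length_lt.le fun q => MvPolynomial.X (rimVertex n q)]
  refine avalancheMonomial_wordSandpile hn w _ _ (fun S hSarc hne => ?_) fun q => ?_
  · by_contra! hS
    have hnear : ∀ q ∈ S, q ≠ i + j ∧ (q + 1 ∈ arc i m → q + 1 ∈ S) ∧
        (q - 1 ∈ arc i m → q - 1 ∈ S) := fun q hq => by
      have := hS q hq
      rw [htwo q (hSarc hq), cyclicDegree] at this
      simp only [Finset.mem_sdiff] at this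
      grind
    have := arc_subset_of_closed hSarc hne (fun q hq => (hnear q hq).2.1)
      (fun q hq => (hnear q hq).2.2) hk
    exact (hnear _ this).1 rfl
  · by_cases hq : q ∈ arc i m
    · rw [if_pos hq, cyclicDegree]
      have := (w q).isLt
      split_ifs <;> lia
    · have hqk : q ≠ i + j := fun h => hq (h ▸ hk)
      simpa [hq, hqk] using h.add_cyclicDegree_arc_lt hw hq

end Wheel

section AvalanchePolynomial

variable {n : ℕ} [NeZero n]

theorem bijective_natCast_fin : Function.Bijective fun i : Fin n => ((i : ℕ) : ZMod n) :=
  Function.bijective_iff_has_inverse.2 ⟨fun i => ⟨i.val, ZMod.val_lt i⟩,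
    fun i => Fin.ext (ZMod.val_natCast_of_lt i.2), ZMod.natCast_zmod_val⟩

theorem wheelVar_mk_mod (k : ℕ) :
    wheelVar n ⟨k % n, Nat.mod_lt _ (NeZero.pos n)⟩ = MvPolynomial.X (rimVertex n k) :=
  congr_arg MvPolynomial.X (Subtype.ext (congr_arg some (Fin.ext (ZMod.val_natCast n k).symm)))

theorem prod_wheelVar :
    ∏ i : Fin n, wheelVar n i = ∏ i : ZMod n, MvPolynomial.X (rimVertex n i) :=
  Fintype.prod_bijective _ bijective_natCast_fin _ _ fun i => by
    rw [← wheelVar_mk_mod]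
    simp only [Nat.mod_eq_of_lt i.2]

theorem cyclicPolynomial_wheelVar (m : ℕ) :
    cyclicPolynomial m (wheelVar n) =
      ∑ i : ZMod n, ∏ t ∈ Finset.range m, MvPolynomial.X (rimVertex n (i + t)) :=
  Fintype.sum_bijective _ bijective_natCast_fin _ _ fun i => Finset.prod_congr rfl fun t _ => by
    rw [wheelVar_mk_mod, Nat.cast_add]

theorem sum_avalancheMonomial_of_ne_two (hn : 3 ≤ n) :
    ∑ w : ZMod n → Fin 3 with IsRecurrentWord w, ∑ k with w k ≠ 2,
      avalancheMonomial (wheelGraph n) (wordSandpile w) (rimVertex n k) =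
      2 * (n : MvPolynomial {v : Option (Fin n) // v ≠ none} ℤ) * (Nat.fib (2 * n - 1) - 1) := by
  have hcard (k : ZMod n) := congr_arg
    (Int.cast : ℤ → MvPolynomial {v : Option (Fin n) // v ≠ none} ℤ)
    (card_isRecurrentWord_apply_ne_two k)
  push_cast at hcard
  calc _ = ∑ w : ZMod n → Fin 3 with IsRecurrentWord w, ∑ k with w k ≠ 2,
          (1 : MvPolynomial {v : Option (Fin n) // v ≠ none} ℤ) :=
        Finset.sum_congr rfl fun w _ => Finset.sum_congr rfl fun k hk =>
          avalancheMonomial_of_ne_two hn (Finset.mem_filter.1 hk).2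
    _ = ∑ k : ZMod n, ∑ w : ZMod n → Fin 3 with IsRecurrentWord w ∧ w k ≠ 2,
          (1 : MvPolynomial {v : Option (Fin n) // v ≠ none} ℤ) :=
        Finset.sum_comm' fun w k => by simp
    _ = _ := by
        simp only [Finset.sum_const, hcard, Finset.card_univ, ZMod.card, nsmul_eq_mul]
        ring

theorem sum_avalancheMonomial_of_isFull (hn : 3 ≤ n) :
    ∑ w : ZMod n → Fin 3 with IsFull w, ∑ k with w k = 2,
      avalancheMonomial (wheelGraph n) (wordSandpile w) (rimVertex n k) =
      (n : MvPolynomial {v : Option (Fin n) // v ≠ none} ℤ) ^ 2 * ∏ i : Fin n, wheelVar n i := by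
  have hsum : ∀ w ∈ Finset.univ.filter (IsFull (n := n)), ∑ k with w k = 2,
      avalancheMonomial (wheelGraph n) (wordSandpile w) (rimVertex n k) =
      (Finset.univ.filter (w · = 2)).card • ∏ i : Fin n, wheelVar n i := fun w hw => by
    rw [prod_wheelVar]
    exact Finset.sum_eq_card_nsmul fun k hk =>
      (Finset.mem_filter.1 hw).2.avalancheMonomial_eq hn (Finset.mem_filter.1 hk).2
  rw [Finset.sum_congr rfl hsum, ← Finset.sum_smul, sum_card_isFull, nsmul_eq_mul, Nat.cast_pow]

theorem sum_avalancheMonomial_eq_sum_isMaximalArc (hn : 3 ≤ n) {w : ZMod n → Fin 3}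
    (hw : ¬IsFull w) :
    ∑ k with w k = 2, avalancheMonomial (wheelGraph n) (wordSandpile w) (rimVertex n k) =
      ∑ m ∈ Finset.Icc 1 (n - 1), ∑ i with IsMaximalArc (w · = 2) i m,
        m • ∏ t ∈ Finset.range m, MvPolynomial.X (rimVertex n (i + t)) := by
  obtain ⟨l, hl⟩ : ∃ l, w l ≠ 2 := by
    by_contra! h
    exact hw ⟨0, fun i _ => h i, by simp [h]⟩
  rw [sum_filter_eq_sum_isMaximalArc hl]
  refine Finset.sum_congr rfl fun m _ => Finset.sum_congr rfl fun i hi => ?_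
  rw [Finset.sum_eq_card_nsmul fun j hj => (Finset.mem_filter.1 hi).2.avalancheMonomial_eq hn hw
    (Finset.mem_range.1 hj), Finset.card_range]

theorem sum_avalancheMonomial_of_not_isFull (hn : 3 ≤ n) :
    ∑ w : ZMod n → Fin 3 with IsRecurrentWord w ∧ ¬IsFull w, ∑ k with w k = 2,
      avalancheMonomial (wheelGraph n) (wordSandpile w) (rimVertex n k) =
      ∑ m ∈ Finset.Icc 1 (n - 1), (m : MvPolynomial {v : Option (Fin n) // v ≠ none} ℤ) *
        Nat.fib (2 * (n - m)) * cyclicPolynomial m (wheelVar n) := by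
  have : Fact (1 < n) := ⟨by lia⟩
  rw [Finset.sum_congr rfl fun w hw =>
    sum_avalancheMonomial_eq_sum_isMaximalArc hn (Finset.mem_filter.1 hw).2.2, Finset.sum_comm]
  refine Finset.sum_congr rfl fun m hm => ?_
  obtain ⟨hpos, hle⟩ := Finset.mem_Icc.1 hm
  have hcard (i : ZMod n) := Int.ofNat_inj.1
    (card_isRecurrentWord_not_isFull_isMaximalArc hpos (by lia : m < n) i)
  rw [Finset.sum_comm' (s' := fun i => Finset.univ.filter fun w : ZMod n → Fin 3 =>
    IsRecurrentWord w ∧ ¬IsFull w ∧ IsMaximalArc (w · = 2) i m) (t' := Finset.univ)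
    fun w i => by simp [and_assoc]]
  simp only [Finset.sum_const, hcard, nsmul_eq_mul, cyclicPolynomial_wheelVar, Finset.mul_sum]
  exact Finset.sum_congr rfl fun i _ => by ring

end AvalanchePolynomial

end AvalancheGraph

theorem theorem5 (n : ℕ) (hn : 3 ≤ n) :
    AvalancheGraph.avalanchePolynomial (AvalancheGraph.wheelGraph n) none =
      (n : MvPolynomial {v : Option (Fin n) // v ≠ none} ℤ) ^ 2 *
          ∏ i : Fin n, AvalancheGraph.wheelVar n i
        + ∑ m ∈ Finset.Icc 1 (n - 1),
            (m : MvPolynomial {v : Option (Fin n) // v ≠ none} ℤ) *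
              (Nat.fib (2 * (n - m)) : MvPolynomial {v : Option (Fin n) // v ≠ none} ℤ) *
              AvalancheGraph.cyclicPolynomial m (AvalancheGraph.wheelVar n)
        + 2 * (n : MvPolynomial {v : Option (Fin n) // v ≠ none} ℤ) *
            ((Nat.fib (2 * n - 1) : MvPolynomial {v : Option (Fin n) // v ≠ none} ℤ) - 1) := by
  have : Fact (1 < n) := ⟨by lia⟩
  have hsplit (w : ZMod n → Fin 3) := Finset.sum_filter_add_sum_filter_not Finset.univ (w · = 2)
    fun k => AvalancheGraph.avalancheMonomial (AvalancheGraph.wheelGraph n)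
      (AvalancheGraph.wordSandpile w) (AvalancheGraph.rimVertex n k)
  rw [AvalancheGraph.avalanchePolynomial, AvalancheGraph.sum_recurrents_wheelGraph hn]
  simp only [← (AvalancheGraph.rimVertex n).sum_comp, ← hsplit, Finset.sum_add_distrib]
  rw [AvalancheGraph.sum_isRecurrentWord_eq_add, AvalancheGraph.sum_avalancheMonomial_of_isFull hn,
    AvalancheGraph.sum_avalancheMonomial_of_not_isFull hn,
    AvalancheGraph.sum_avalancheMonomial_of_ne_two hn]
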